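/- Let $k\ge 1$ and let $\theta=(\mu_1,\dots,\mu_k,\sigma_1,\dots,\sigma_k)$ parametrize the $k$-dimensional Gaussian law $N_\theta=N\big((\mu_1,\dots,\mu_k),\operatorname{diag}(\sigma_1^2,\dots,\sigma_k^2)\big)$. Let $g_1,\dots,g_d$ ($1\le d\le 2k$) be distinct coordinates of $\theta$ (the secrets), let $\epsilon_1,\dots,\epsilon_d>0$ be tolerance ranges and $s_{g_1},\dots,s_{g_d}$ interval lengths with $2\epsilon_i<s_{g_i}$. The parameter $\theta$ is random with a prior law $P$ under which all $\sigma_j\ge 0$ almost surely; each secret $g_i(\theta)$ is uniform on $[\underline{g_i},\,\underline{g_i}+m_i s_{g_i}]$ for some integer $m_i\ge 1$; and the secrets are mutually independent and independent of the vector of non-secret coordinates, whose law is arbitrary. A mechanism is a Markov kernel $\mathcal M$ on $\mathbb R^{2k}$ that maps $\theta$ to a random released parameter $\theta'\sim\mathcal M(\theta)$. Its union privacy is $$\Pi^{\mathrm{union}}(\mathcal M)=\sup_{\hat g}\ \mathbb P\Big(\exists\, i\in\{1,\dots,d\}:\ |\hat g_i(\theta')-g_i(\theta)|\le\epsilon_i\Big),$$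 the supremum being over all (possibly randomized) attack strategies $\hat g=(\hat g_1,\dots,\hat g_d)$, and its distortion is $$\Delta(\mathcal M)=\sup_{\theta\in\operatorname{supp}P,\ \theta'\in\operatorname{supp}\mathcal M(\theta)} W_2(N_\theta,N_{\theta'}),$$ where $W_2$ is the Wasserstein-2 distance. Let $\mathcal M_{\mathrm{Alg}}$ be the quantization mechanism that replaces each secret $g_i(\theta)$ by $$\underline{g_i}+\Big\lfloor\frac{g_i(\theta)-\underline{g_i}}{s_{g_i}}\Big\rfloor s_{g_i}+U_i,$$ with independent $U_i$ uniform on $(0,s_{g_i})$, and keeps all non-secret coordinates. Then $$\Pi^{\mathrm{union}}(\mathcal M_{\mathrm{Alg}})=1-\prod_{i=1}^d\Big(1-\frac{2\epsilon_i}{s_{g_i}}\Big),\qquad \Delta(\mathcal M_{\mathrm{Alg}})=\sqrt{\sum_{i=1}^d s_{g_i}^2}.$$ Moreover, let $\Delta_{\mathrm{opt}}=\inf\{\Delta(\mathcal M):\ \Pi^{\mathrm{union}}(\mathcal M)\le \Pi^{\mathrm{union}}(\mathcal M_{\mathrm{Alg}})\}$ be the optimal distortion at the same privacy level, and put $c_1=\min_i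 \epsilon_i/s_{g_i}$, $c_2=\max_i\epsilon_i/s_{g_i}$ and $$C_{\epsilon,s}=\frac{\sqrt{\sum_{i}\epsilon_i^2}}{\big(\prod_{i}\epsilon_i\big)^{1/d}}\cdot\frac{2c_2}{c_1(1-2c_2)},$$ which depends only on the tolerance ranges and the interval lengths. Then $\Delta(\mathcal M_{\mathrm{Alg}})<c\,\Delta_{\mathrm{opt}}$ for every real $c>C_{\epsilon,s}$. -/

import Mathlib

open MeasureTheory ProbabilityTheory
open scoped ENNReal

noncomputable section

/-- Parameter vectors `θ = (μ₁, …, μ_k, σ₁, …, σ_k)` of `k`-dimensional Gaussian distributions with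
diagonal covariance matrix: `θ (Sum.inl j) = μ_j` and `θ (Sum.inr j) = σ_j`. -/
abbrev GaussParam (k : ℕ) : Type := Fin k ⊕ Fin k → ℝ

/-- The Gaussian distribution `N((μ₁, …, μ_k), diag(σ₁², …, σ_k²))` on Euclidean space. -/
def gaussLaw {k : ℕ} (θ : GaussParam k) : Measure (EuclideanSpace ℝ (Fin k)) :=
  multivariateGaussian (WithLp.toLp 2 fun j => θ (Sum.inl j))
    (Matrix.diagonal fun j => θ (Sum.inr j) ^ 2)

/-- The Wasserstein-2 distance: the square root of the least expected squared distance over all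
couplings of `μ` and `ν`. -/
def wasserstein2 {E : Type*} [PseudoEMetricSpace E] [MeasurableSpace E] (μ ν : Measure E) :
    ℝ≥0∞ :=
  (⨅ (π : Measure (E × E)) (_ : π.map Prod.fst = μ) (_ : π.map Prod.snd = ν),
    ∫⁻ z, edist z.1 z.2 ^ 2 ∂π) ^ (1 / 2 : ℝ)

/-- Union privacy of the mechanism `M` for the secrets `θ ↦ θ (g i)`, with prior `P` and tolerance
ranges `ε i`: the supremum, over all (possibly randomized) attack strategies `A`, of the probability
that for at least one `i` the guess of the `i`-th secret made from the released parameter is within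
`ε i` of its true value. -/
def unionPrivacy {k d : ℕ} (P : Measure (GaussParam k)) (g : Fin d → Fin k ⊕ Fin k)
    (ε : Fin d → ℝ) (M : Kernel (GaussParam k) (GaussParam k)) : ℝ≥0∞ :=
  ⨆ (A : Kernel (GaussParam k) (Fin d → ℝ)) (_ : IsMarkovKernel A),
    ∫⁻ θ, ∫⁻ θ', A θ' {guess | ∃ i, |guess i - θ (g i)| ≤ ε i} ∂(M θ) ∂P

/-- Distortion of the mechanism `M` under the prior `P`: the worst-case Wasserstein-2 distance
between the original and the released distribution. -/
def distortion {k : ℕ} (P : Measure (GaussParam k)) (M : Kernel (GaussParam k) (GaussParam k)) :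
    ℝ≥0∞ :=
  ⨆ θ ∈ P.support, ⨆ θ' ∈ (M θ).support, wasserstein2 (gaussLaw θ) (gaussLaw θ')

/-- The optimal distortion: the infimum of the distortion over all data release mechanisms (Markov
kernels on the parameter space) with union privacy at most `T`. -/
def optDistortion {k d : ℕ} (P : Measure (GaussParam k)) (g : Fin d → Fin k ⊕ Fin k)
    (ε : Fin d → ℝ) (T : ℝ≥0∞) : ℝ≥0∞ :=
  ⨅ (M : Kernel (GaussParam k) (GaussParam k)) (_ : IsMarkovKernel M)
    (_ : unionPrivacy P g ε M ≤ T), distortion P M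

/-- The parameter released by the quantization mechanism on input `θ` when its internal noise is `u`:
the secret coordinate `g i` becomes `lo i + ⌊(θ (g i) - lo i) / s i⌋ * s i + u i`, and every
coordinate that is not a secret keeps its value. -/
def quantizeParam {k d : ℕ} (g : Fin d → Fin k ⊕ Fin k) (lo s : Fin d → ℝ) (θ : GaussParam k)
    (u : Fin d → ℝ) : GaussParam k :=
  Function.extend g (fun i => lo i + ⌊(θ (g i) - lo i) / s i⌋ * s i + u i) θ

/-- Independent noise, the `i`-th component uniform on `(0, s i)`. -/
def quantizeNoise {d : ℕ} (s : Fin d → ℝ) : Measure (Fin d → ℝ) :=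
  Measure.pi fun i => cond volume (Set.Ioo 0 (s i))

lemma measurable_quantizeParam {k d : ℕ} (g : Fin d → Fin k ⊕ Fin k) (lo s : Fin d → ℝ) :
    Measurable fun p : GaussParam k × (Fin d → ℝ) => quantizeParam g lo s p.1 p.2 := by
  classical
  refine measurable_pi_lambda _ fun j => ?_
  by_cases h : ∃ i, g i = j
  · simp only [quantizeParam, Function.extend_def, h, dite_true]
    fun_prop
  · simp only [quantizeParam, Function.extend_def, h, dite_false]
    fun_prop

/-- The quantization mechanism: quantize every secret and add independent uniform noise. -/
def quantizationMechanism {k d : ℕ} (g : Fin d → Fin k ⊕ Fin k) (lo s : Fin d → ℝ) :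
    Kernel (GaussParam k) (GaussParam k) where
  toFun θ := (quantizeNoise s).map (quantizeParam g lo s θ)
  measurable' := by
    have : SFinite (quantizeNoise s) := by unfold quantizeNoise; infer_instance
    refine Measure.measurable_of_measurable_coe _ fun B hB => ?_
    have hm := measurable_quantizeParam g lo s
    have h : ∀ θ, (quantizeNoise s).map (quantizeParam g lo s θ) B
        = quantizeNoise s (Prod.mk θ ⁻¹'
          ((fun p : GaussParam k × (Fin d → ℝ) => quantizeParam g lo s p.1 p.2) ⁻¹' B)) := by
      intro θ
      have hθ : Measurable (quantizeParam g lo s θ) :=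
        Measurable.of_uncurry_left (f := quantizeParam g lo s) hm
      rw [Measure.map_apply hθ hB]
      rfl
    simp_rw [h]
    exact measurable_measure_prodMk_left (hm hB)

/-- The secrets are mutually independent, independent of the vector of all non-secret parameters
(whose law is arbitrary), the `i`-th secret is uniform on `[lo i, hi i]`, and standard deviations
are nonnegative. -/
structure UniformSecretsPrior {k d : ℕ} (P : Measure (GaussParam k)) (g : Fin d → Fin k ⊕ Fin k)
    (lo hi : Fin d → ℝ) : Prop where
  isProbabilityMeasure : IsProbabilityMeasure P
  uniform : ∀ i, pdf.IsUniform (fun θ : GaussParam k => θ (g i)) (Set.Icc (lo i) (hi i)) P volume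
  indep : iIndepFun (fun i (θ : GaussParam k) => θ (g i)) P
  indep_nonsecret : IndepFun (fun (θ : GaussParam k) (i : Fin d) => θ (g i))
    (fun (θ : GaussParam k) (j : {j // j ∉ Set.range g}) => θ j) P
  sd_nonneg : ∀ᵐ θ ∂P, ∀ j, 0 ≤ θ (Sum.inr j)

/-- With `c₁ = minᵢ εᵢ / sᵢ` and `c₂ = maxᵢ εᵢ / sᵢ`, the constant
`√(∑ᵢ εᵢ²) / (∏ᵢ εᵢ)^(1/d) * (2 c₂ / (c₁ (1 - 2 c₂)))`. -/
def tradeoffConst {d : ℕ} (ε s : Fin d → ℝ) : ℝ :=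
  √(∑ i, ε i ^ 2) / (∏ i, ε i) ^ (1 / d : ℝ) *
    (2 * (⨆ i, ε i / s i) / ((⨅ i, ε i / s i) * (1 - 2 * ⨆ i, ε i / s i)))

end

/-! For diagonal Gaussians with nonnegative standard deviations, `W₂` is the Euclidean distance of
the parameter vectors (`wasserstein2_gaussLaw`), so distortion is a question about distances in
parameter space.

Privacy of the quantization mechanism: redrawing each secret uniformly inside its cell preserves the
prior, and the released value reveals only the cell. Given the release, the true secrets are
therefore independent and uniform in their cells (`lintegral_kernel_resample`). A guess hits the
`i`-th secret with conditional probability at most `2 εᵢ / sᵢ`, with equality at the midpoint of the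
cell. Its distortion is the diagonal of a cell.

Optimality: a mechanism of finite distortion `r` releases every coordinate to within `r`, up to the
sign of standard deviations. Guessing uniformly within `r + εᵢ` of the release hits with probability
`εᵢ / (r + εᵢ)`, independently over `i`, so the privacy constraint forces `∏ (1 - 2 εᵢ / sᵢ) ≤ ∏ r /
(r + εᵢ)`. The AM-GM inequality turns this into a lower bound for `r`
(`sqrt_sum_sq_le_tradeoffConst_mul`). -/

/-! ### The Wasserstein-2 distance of diagonal Gaussian distributions -/

/-- The covariance of square-integrable random variables is at most the product of their standard
deviations. -/
lemma covariance_le_sqrt_variance_mul {Ω : Type*} [MeasurableSpace Ω] {μ : Measure Ω}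
    [IsProbabilityMeasure μ] {X Y : Ω → ℝ} (hX : MemLp X 2 μ) (hY : MemLp Y 2 μ) :
    cov[X, Y; μ] ≤ √Var[X; μ] * √Var[Y; μ] := by
  -- The quadratic is `Var[t X - Y]`, so its discriminant is nonpositive.
  have h : ∀ t : ℝ, 0 ≤ Var[X; μ] * (t * t) + (-2 * cov[X, Y; μ]) * t + Var[Y; μ] := by
    intro t
    have h1 := variance_sub (hX.const_mul t) hY
    rw [variance_const_mul, covariance_const_mul_left] at h1
    have h2 := variance_nonneg ((fun ω => t * X ω) - Y) μ
    nlinarith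
  have hd := discrim_le_zero h
  rw [← Real.sqrt_mul (variance_nonneg X μ)]
  apply Real.le_sqrt_of_sq_le
  rw [discrim] at hd
  nlinarith

/-- A lower bound for the mean squared difference of two random variables in terms of their means
and standard deviations. -/
lemma sq_sub_add_sq_sub_le_integral {Ω : Type*} [MeasurableSpace Ω] {μ : Measure Ω}
    [IsProbabilityMeasure μ] {X Y : Ω → ℝ} (hX : MemLp X 2 μ) (hY : MemLp Y 2 μ) :
    (μ[X] - μ[Y]) ^ 2 + (√Var[X; μ] - √Var[Y; μ]) ^ 2 ≤ ∫ ω, (X ω - Y ω) ^ 2 ∂μ := by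
  -- The mean square of `X - Y` is its variance plus its squared mean, and the covariance bound
  -- gives `Var[X - Y] ≥ (√Var X - √Var Y)²`.
  have h1 := variance_eq_sub (hX.sub hY)
  have h2 := variance_sub hX hY
  have h3 := covariance_le_sqrt_variance_mul hX hY
  have h4 : μ[X - Y] = μ[X] - μ[Y] :=
    integral_sub (hX.integrable one_le_two) (hY.integrable one_le_two)
  have h5 : ∫ ω, (X ω - Y ω) ^ 2 ∂μ = μ[(X - Y) ^ 2] := rfl
  have h6 := Real.sq_sqrt (variance_nonneg X μ)
  have h7 := Real.sq_sqrt (variance_nonneg Y μ)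
  rw [h4] at h1
  rw [h5]
  nlinarith

lemma posSemidef_diagonal_sq {k : ℕ} (a : Fin k → ℝ) :
    (Matrix.diagonal fun j => a j ^ 2).PosSemidef :=
  Matrix.PosSemidef.diagonal fun j => sq_nonneg (a j)

lemma map_eval_gaussLaw {k : ℕ} (θ : GaussParam k) (j : Fin k) :
    (gaussLaw θ).map (fun x => x j)
      = gaussianReal (θ (Sum.inl j)) (θ (Sum.inr j) ^ 2).toNNReal := by
  have h := (measurePreserving_eval_multivariateGaussian
    (μ := WithLp.toLp 2 fun j => θ (Sum.inl j))
    (posSemidef_diagonal_sq fun j => θ (Sum.inr j)) (i := j)).map_eq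
  simpa [gaussLaw] using h

instance isProbabilityMeasure_gaussLaw {k : ℕ} (θ : GaussParam k) :
    IsProbabilityMeasure (gaussLaw θ) := by
  unfold gaussLaw; infer_instance

/-- The explicit squared Wasserstein-2 distance of two diagonal Gaussian distributions. -/
noncomputable def gaussDistSq {k : ℕ} (θ θ' : GaussParam k) : ℝ :=
  ∑ j, ((θ (Sum.inl j) - θ' (Sum.inl j)) ^ 2 + (|θ (Sum.inr j)| - |θ' (Sum.inr j)|) ^ 2)

lemma edist_sq_eq_ofReal {k : ℕ} (x y : EuclideanSpace ℝ (Fin k)) :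
    edist x y ^ 2 = ENNReal.ofReal (∑ j, (x j - y j) ^ 2) := by
  rw [edist_dist, ← ENNReal.ofReal_pow dist_nonneg, EuclideanSpace.dist_eq,
    Real.sq_sqrt (Finset.sum_nonneg fun _ _ => sq_nonneg _)]
  simp [Real.dist_eq, sq_abs]

lemma ofReal_sqrt_eq_rpow {x : ℝ} (hx : 0 ≤ x) :
    ENNReal.ofReal √x = ENNReal.ofReal x ^ (1 / 2 : ℝ) := by
  rw [Real.sqrt_eq_rpow, ENNReal.ofReal_rpow_of_nonneg hx (by norm_num)]

lemma gaussDistSq_nonneg {k : ℕ} (θ θ' : GaussParam k) : 0 ≤ gaussDistSq θ θ' :=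
  Finset.sum_nonneg fun _ _ => by positivity

/-- The cost of any coupling splits over the coordinates, and each summand is bounded below by the
means and standard deviations of its two marginals. No sign condition is imposed, because an
arbitrary mechanism may release negative `σ`; the law sees only `|σ|`. -/
theorem le_wasserstein2_gaussLaw {k : ℕ} (θ θ' : GaussParam k) :
    ENNReal.ofReal √(gaussDistSq θ θ') ≤ wasserstein2 (gaussLaw θ) (gaussLaw θ') := by
  rw [ofReal_sqrt_eq_rpow (gaussDistSq_nonneg θ θ'), wasserstein2]
  refine ENNReal.rpow_le_rpow (le_iInf fun π => le_iInf fun h1 => le_iInf fun h2 => ?_)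
    (by norm_num)
  have hπ : IsProbabilityMeasure π :=
    ⟨by rw [← Set.preimage_univ (f := Prod.fst), ← Measure.map_apply measurable_fst .univ, h1,
      measure_univ]⟩
  have hX (j : Fin k) : π.map (fun z => z.1 j)
      = gaussianReal (θ (Sum.inl j)) (θ (Sum.inr j) ^ 2).toNNReal := by
    rw [← map_eval_gaussLaw, ← h1, Measure.map_map (by fun_prop) (by fun_prop)]; rfl
  have hY (j : Fin k) : π.map (fun z => z.2 j)
      = gaussianReal (θ' (Sum.inl j)) (θ' (Sum.inr j) ^ 2).toNNReal := by
    rw [← map_eval_gaussLaw, ← h2, Measure.map_map (by fun_prop) (by fun_prop)]; rfl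
  have key : ∀ (f : EuclideanSpace ℝ (Fin k) × EuclideanSpace ℝ (Fin k) → ℝ) (hf : Measurable f)
      (a b : ℝ), π.map f = gaussianReal a (b ^ 2).toNNReal →
      MemLp f 2 π ∧ π[f] = a ∧ √Var[f; π] = |b| := by
    intro f hf a b h
    refine ⟨?_, ?_, ?_⟩
    · have := memLp_id_gaussianReal (μ := a) (v := (b ^ 2).toNNReal) 2
      rw [← h, memLp_map_measure_iff (by fun_prop) hf.aemeasurable] at this
      exact this
    · have := integral_id_gaussianReal (μ := a) (v := (b ^ 2).toNNReal)
      rw [← h, integral_map hf.aemeasurable (by fun_prop)] at this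
      exact this
    · have := variance_id_gaussianReal (μ := a) (v := (b ^ 2).toNNReal)
      rw [← h, variance_map (by fun_prop) hf.aemeasurable] at this
      rw [← Real.sqrt_sq_eq_abs]
      congr 1
      rw [← Real.coe_toNNReal (b ^ 2) (sq_nonneg b), ← this]; rfl
  simp_rw [edist_sq_eq_ofReal]
  have hint (j : Fin k) : Integrable (fun z : EuclideanSpace ℝ (Fin k) × EuclideanSpace ℝ (Fin k) =>
      (z.1 j - z.2 j) ^ 2) π :=
    ((key _ (by fun_prop) _ _ (hX j)).1.sub (key _ (by fun_prop) _ _ (hY j)).1).integrable_sq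
  rw [← ofReal_integral_eq_lintegral_ofReal (integrable_finsetSum _ fun j _ => hint j)
    (Filter.Eventually.of_forall fun z => Finset.sum_nonneg fun _ _ => sq_nonneg _),
    integral_finsetSum _ fun j _ => hint j]
  refine ENNReal.ofReal_le_ofReal (Finset.sum_le_sum fun j _ => ?_)
  obtain ⟨m1, e1, v1⟩ := key _ (by fun_prop) _ _ (hX j)
  obtain ⟨m2, e2, v2⟩ := key _ (by fun_prop) _ _ (hY j)
  have := sq_sub_add_sq_sub_le_integral m1 m2
  rwa [e1, e2, v1, v2] at this

open scoped MatrixOrder in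
lemma gaussLaw_eq_map_stdGaussian {k : ℕ} {θ : GaussParam k} (hθ : ∀ j, 0 ≤ θ (Sum.inr j)) :
    gaussLaw θ = (stdGaussian (EuclideanSpace ℝ (Fin k))).map
      (fun x => WithLp.toLp 2 fun j => θ (Sum.inl j) + θ (Sum.inr j) * x j) := by
  -- Nonnegativity of `σ` makes `diag(σ)` the positive semidefinite root of `diag(σ²)`.
  have hs : CFC.sqrt (Matrix.diagonal fun j => θ (Sum.inr j) ^ 2)
      = Matrix.diagonal fun j => θ (Sum.inr j) := by
    refine CFC.sqrt_unique ?_ (Matrix.PosSemidef.diagonal hθ).nonneg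
    simp [Matrix.diagonal_mul_diagonal, sq]
  rw [gaussLaw, multivariateGaussian, hs]
  congr 1
  ext x j
  simp [Matrix.mulVec_diagonal]

/-- The lower bound is attained by driving both laws with the same standard Gaussian vector through
their affine maps. -/
theorem wasserstein2_gaussLaw {k : ℕ} {θ θ' : GaussParam k} (hθ : ∀ j, 0 ≤ θ (Sum.inr j))
    (hθ' : ∀ j, 0 ≤ θ' (Sum.inr j)) :
    wasserstein2 (gaussLaw θ) (gaussLaw θ') = ENNReal.ofReal √(∑ j, (θ j - θ' j) ^ 2) := by
  have hd : gaussDistSq θ θ' = ∑ j, (θ j - θ' j) ^ 2 := by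
    simp [gaussDistSq, Finset.sum_add_distrib, abs_of_nonneg (hθ _), abs_of_nonneg (hθ' _)]
  rw [← hd]
  refine le_antisymm ?_ (le_wasserstein2_gaussLaw θ θ')
  set Z := stdGaussian (EuclideanSpace ℝ (Fin k))
  let F : GaussParam k → EuclideanSpace ℝ (Fin k) → EuclideanSpace ℝ (Fin k) :=
    fun θ x => WithLp.toLp 2 fun j => θ (Sum.inl j) + θ (Sum.inr j) * x j
  have hF (θ : GaussParam k) : Measurable (F θ) := by
    refine (by fun_prop : Measurable (WithLp.toLp 2 : (Fin k → ℝ) → _)).comp ?_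
    fun_prop
  rw [ofReal_sqrt_eq_rpow (gaussDistSq_nonneg θ θ'), wasserstein2]
  refine ENNReal.rpow_le_rpow (iInf_le_of_le (Z.map fun x => (F θ x, F θ' x))
    (iInf₂_le_of_le ?_ ?_ ?_)) (by norm_num)
  · rw [Measure.map_map measurable_fst ((hF θ).prodMk (hF θ')), gaussLaw_eq_map_stdGaussian hθ]
    rfl
  · rw [Measure.map_map measurable_snd ((hF θ).prodMk (hF θ')), gaussLaw_eq_map_stdGaussian hθ']
    rfl
  have hZ (j : Fin k) : Z.map (fun x => x j) = gaussianReal 0 1 := by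
    have h := (measurePreserving_eval_multivariateGaussian
      (μ := (0 : EuclideanSpace ℝ (Fin k))) (S := 1) Matrix.PosSemidef.one (i := j)).map_eq
    simpa using h
  have hm (j : Fin k) : MemLp (fun x : EuclideanSpace ℝ (Fin k) => x j) 2 Z := by
    have := memLp_id_gaussianReal (μ := 0) (v := 1) 2
    rw [← hZ j, memLp_map_measure_iff (by fun_prop) (by fun_prop)] at this
    exact this
  have h0 (j : Fin k) : ∫ x, x j ∂Z = 0 := by
    have := integral_id_gaussianReal (μ := 0) (v := 1)
    rw [← hZ j, integral_map (by fun_prop) (by fun_prop)] at this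
    exact this
  have h1 (j : Fin k) : ∫ x, x j ^ 2 ∂Z = 1 := by
    have h := variance_id_gaussianReal (μ := 0) (v := 1)
    rw [← hZ j, variance_map (by fun_prop) (by fun_prop)] at h
    have h' := variance_eq_sub (hm j)
    simp only [h0] at h'
    have h'' : Var[fun x : EuclideanSpace ℝ (Fin k) => x j; Z] = 1 := by simpa using h
    rw [h''] at h'
    simpa using h'.symm
  rw [lintegral_map (by fun_prop) ((hF θ).prodMk (hF θ'))]
  simp_rw [edist_sq_eq_ofReal]
  -- After integration the linear term vanishes and `x j ^ 2` contributes `1`.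
  have e (x : EuclideanSpace ℝ (Fin k)) (j : Fin k) : (F θ x j - F θ' x j) ^ 2
      = (θ (Sum.inl j) - θ' (Sum.inl j)) ^ 2
        + 2 * (θ (Sum.inl j) - θ' (Sum.inl j)) * (θ (Sum.inr j) - θ' (Sum.inr j)) * x j
        + (θ (Sum.inr j) - θ' (Sum.inr j)) ^ 2 * x j ^ 2 := by
    simp only [F]; ring
  simp_rw [e]
  have i1 (j : Fin k) (a : ℝ) : Integrable (fun x : EuclideanSpace ℝ (Fin k) => a * x j) Z :=
    ((hm j).integrable one_le_two).const_mul a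
  have i2 (j : Fin k) (a : ℝ) : Integrable (fun x : EuclideanSpace ℝ (Fin k) => a * x j ^ 2) Z :=
    ((hm j).integrable_sq).const_mul a
  have i3 (j : Fin k) : Integrable (fun x : EuclideanSpace ℝ (Fin k) =>
      (θ (Sum.inl j) - θ' (Sum.inl j)) ^ 2
        + 2 * (θ (Sum.inl j) - θ' (Sum.inl j)) * (θ (Sum.inr j) - θ' (Sum.inr j)) * x j
        + (θ (Sum.inr j) - θ' (Sum.inr j)) ^ 2 * x j ^ 2) Z :=
    ((integrable_const _).add (i1 j _)).add (i2 j _)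
  rw [← ofReal_integral_eq_lintegral_ofReal (integrable_finsetSum _ fun j _ => i3 j)
    (Filter.Eventually.of_forall fun z => Finset.sum_nonneg fun j _ => by
      rw [← e]; positivity),
    integral_finsetSum _ fun j _ => i3 j]
  refine ENNReal.ofReal_le_ofReal (Finset.sum_le_sum fun j _ => ?_)
  have i4 (a b : ℝ) : Integrable (fun x : EuclideanSpace ℝ (Fin k) => a + b * x j) Z :=
    (integrable_const _).add (i1 j _)
  rw [integral_add (i4 _ _) (i2 j _), integral_add (integrable_const _) (i1 j _),
    integral_const_mul, integral_const_mul, h0, h1]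
  simp [abs_of_nonneg (hθ _), abs_of_nonneg (hθ' _)]

/-! ### Resampling uniform variables inside the cells of a grid -/

lemma floor_cell_eq {lo s x : ℝ} (hs : 0 < s) {n : ℤ} (h1 : lo + n * s ≤ x)
    (h2 : x < lo + n * s + s) : ⌊(x - lo) / s⌋ = n := by
  rw [Int.floor_eq_iff, le_div_iff₀ hs, div_lt_iff₀ hs]
  constructor <;> linarith

lemma cond_volume_Ioo_apply {s : ℝ} (B : Set ℝ) :
    cond volume (Set.Ioo 0 s) B = (ENNReal.ofReal s)⁻¹ * volume (Set.Ioo 0 s ∩ B) := by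
  rw [cond_apply measurableSet_Ioo, Real.volume_Ioo, sub_zero]

lemma isProbabilityMeasure_cond_Ioo {s : ℝ} (hs : 0 < s) :
    IsProbabilityMeasure (cond (volume : Measure ℝ) (Set.Ioo 0 s)) :=
  cond_isProbabilityMeasure_of_finite (by simpa using hs) (by simp)

/-- On one cell the floor is constant, so the integrand is the constant proportion of the cell lying
in `B`; multiplying by the cell length returns the volume of that part. Induction adds one cell at a
time. Half-open cells tile the interval, and endpoints are null. -/
lemma setLIntegral_cond_cell {s : ℝ} (hs : 0 < s) (lo : ℝ) {B : Set ℝ} (hB : MeasurableSet B)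
    (m : ℕ) :
    ∫⁻ x in Set.Ico lo (lo + m * s),
        cond volume (Set.Ioo 0 s) {v | lo + ⌊(x - lo) / s⌋ * s + v ∈ B}
      = volume (Set.Ico lo (lo + m * s) ∩ B) := by
  induction m with
  | zero => simp
  | succ m ih =>
    have hms : (0 : ℝ) ≤ m * s := by positivity
    have hU : Set.Ico lo (lo + (m + 1 : ℕ) * s)
        = Set.Ico lo (lo + m * s) ∪ Set.Ico (lo + m * s) (lo + m * s + s) := by
      rw [Set.Ico_union_Ico_eq_Ico (by linarith) (by linarith)]
      push_cast
      ring_nf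
    have hdisj : Disjoint (Set.Ico lo (lo + m * s)) (Set.Ico (lo + m * s) (lo + m * s + s)) :=
      Set.Ico_disjoint_Ico_same
    have h2 : ∫⁻ x in Set.Ico (lo + m * s) (lo + m * s + s),
        cond volume (Set.Ioo 0 s) {v | lo + ⌊(x - lo) / s⌋ * s + v ∈ B}
        = volume (Set.Ico (lo + m * s) (lo + m * s + s) ∩ B) := by
      have hc : ∀ x ∈ Set.Ico (lo + m * s) (lo + m * s + s),
          cond volume (Set.Ioo 0 s) {v | lo + ⌊(x - lo) / s⌋ * s + v ∈ B}
            = (ENNReal.ofReal s)⁻¹ * volume (Set.Ico (lo + m * s) (lo + m * s + s) ∩ B) := by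
        intro x hx
        have hn : ⌊(x - lo) / s⌋ = (m : ℤ) :=
          floor_cell_eq hs (by simpa using hx.1) (by simpa using hx.2)
        rw [hn, cond_volume_Ioo_apply]
        congr 1
        have e : Set.Ioo 0 s ∩ {v | lo + ((m : ℤ) : ℝ) * s + v ∈ B}
            = (fun v => (lo + m * s) + v) ⁻¹' (Set.Ioo (lo + m * s) (lo + m * s + s) ∩ B) := by
          ext v; simp
        rw [e, measure_preimage_add]
        exact measure_congr (Ioo_ae_eq_Ico.inter (Filter.EventuallyEq.refl _ _))
      rw [setLIntegral_congr_fun measurableSet_Ico hc, setLIntegral_const, Real.volume_Ico,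
        add_sub_cancel_left, mul_right_comm, ENNReal.inv_mul_cancel (by simpa using hs) (by simp),
        one_mul]
    rw [hU, lintegral_union measurableSet_Ico hdisj, ih, h2, Set.union_inter_distrib_right,
      measure_union (hdisj.mono Set.inter_subset_left Set.inter_subset_left)
        (measurableSet_Ico.inter hB)]

/-- Keeping the grid cell of a uniform random variable and resampling its position inside the cell
leaves its distribution unchanged. -/
lemma measurePreserving_resample_cell {s : ℝ} (hs : 0 < s) (lo : ℝ) (m : ℕ) :
    MeasurePreserving (fun p : ℝ × ℝ => lo + ⌊(p.1 - lo) / s⌋ * s + p.2)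
      ((cond volume (Set.Icc lo (lo + m * s))).prod (cond volume (Set.Ioo 0 s)))
      (cond volume (Set.Icc lo (lo + m * s))) := by
  have hmeas : Measurable fun p : ℝ × ℝ => lo + ⌊(p.1 - lo) / s⌋ * s + p.2 := by fun_prop
  have := isProbabilityMeasure_cond_Ioo hs
  refine ⟨hmeas, Measure.ext fun B hB => ?_⟩
  -- The right endpoint of the closed interval would open a further cell; it is a null set and is
  -- dropped.
  rw [Measure.map_apply hmeas hB, Measure.prod_apply (hmeas hB), ProbabilityTheory.cond,
    lintegral_smul_measure, Measure.smul_apply, Measure.restrict_apply hB,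
    Measure.restrict_congr_set Ico_ae_eq_Icc.symm, Set.inter_comm B]
  congr 1
  refine (setLIntegral_cond_cell hs lo hB m).trans
    (measure_congr (Ico_ae_eq_Icc.inter (Filter.EventuallyEq.refl _ _)))

lemma isProbabilityMeasure_quantizeNoise {d : ℕ} {s : Fin d → ℝ} (hs : ∀ i, 0 < s i) :
    IsProbabilityMeasure (quantizeNoise s) := by
  have (i : Fin d) := isProbabilityMeasure_cond_Ioo (hs i)
  unfold quantizeNoise; infer_instance

lemma ae_quantizeNoise_mem {d : ℕ} {s : Fin d → ℝ} (hs : ∀ i, 0 < s i) :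
    ∀ᵐ v ∂quantizeNoise s, ∀ i, v i ∈ Set.Ioo 0 (s i) := by
  have (i : Fin d) := isProbabilityMeasure_cond_Ioo (hs i)
  rw [Filter.eventually_all]
  intro i
  exact Measure.tendsto_eval_ae_ae.eventually (ae_cond_mem measurableSet_Ioo)

lemma measurePreserving_resample_cells {d : ℕ} {s : Fin d → ℝ} (hs : ∀ i, 0 < s i)
    (lo : Fin d → ℝ) (m : Fin d → ℕ) :
    MeasurePreserving
      (fun (p : (Fin d → ℝ) × (Fin d → ℝ)) i => lo i + ⌊(p.1 i - lo i) / s i⌋ * s i + p.2 i)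
      ((Measure.pi fun i => cond volume (Set.Icc (lo i) (lo i + m i * s i))).prod
        (quantizeNoise s))
      (Measure.pi fun i => cond volume (Set.Icc (lo i) (lo i + m i * s i))) := by
  let U (i : Fin d) : Measure ℝ := cond volume (Set.Icc (lo i) (lo i + m i * s i))
  let N (i : Fin d) : Measure ℝ := cond volume (Set.Ioo 0 (s i))
  have h1 : MeasurePreserving
      (fun (p : Fin d → ℝ × ℝ) i => lo i + ⌊((p i).1 - lo i) / s i⌋ * s i + (p i).2)
      (Measure.pi fun i => (U i).prod (N i)) (Measure.pi U) :=
    measurePreserving_pi (fun i => (U i).prod (N i)) U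
      fun i => measurePreserving_resample_cell (hs i) (lo i) (m i)
  -- A pair of independent vectors is rearranged into a vector of independent pairs, where the
  -- one-dimensional result applies coordinatewise.
  have h2 := measurePreserving_arrowProdEquivProdArrow ℝ ℝ (Fin d) U N
  refine ⟨by fun_prop, ?_⟩
  change Measure.map _ ((Measure.pi U).prod (Measure.pi N)) = Measure.pi U
  rw [← h2.map_eq, Measure.map_map (by fun_prop) h2.measurable]
  exact h1.map_eq

/-! ### Structure of the prior -/

section Prior

variable {k d : ℕ} {g : Fin d → Fin k ⊕ Fin k} {lo s : Fin d → ℝ}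

lemma quantizeParam_secret (hg : Function.Injective g) (θ : GaussParam k) (u : Fin d → ℝ)
    (i : Fin d) :
    quantizeParam g lo s θ u (g i) = lo i + ⌊(θ (g i) - lo i) / s i⌋ * s i + u i := by
  rw [quantizeParam, hg.extend_apply]

lemma quantizeParam_nonsecret {j : Fin k ⊕ Fin k} (hj : j ∉ Set.range g) (θ : GaussParam k)
    (u : Fin d → ℝ) : quantizeParam g lo s θ u j = θ j := by
  rw [quantizeParam, Function.extend_apply' _ _ _ (by simpa using hj)]

/-- The cell of a secret is not changed by quantization. -/
lemma floor_quantizeParam (hg : Function.Injective g) (hs : ∀ i, 0 < s i) (θ : GaussParam k)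
    {v : Fin d → ℝ} (hv : ∀ i, v i ∈ Set.Ioo 0 (s i)) (i : Fin d) :
    ⌊(quantizeParam g lo s θ v (g i) - lo i) / s i⌋ = ⌊(θ (g i) - lo i) / s i⌋ := by
  rw [quantizeParam_secret hg]
  exact floor_cell_eq (hs i) (by linarith [(hv i).1]) (by linarith [(hv i).2])

/-- Quantization uses a secret only through its cell, which the first application preserves. This
makes the release insensitive to resampling the true secrets. -/
lemma quantizeParam_quantizeParam (hg : Function.Injective g) (hs : ∀ i, 0 < s i)
    (θ : GaussParam k) {v : Fin d → ℝ} (hv : ∀ i, v i ∈ Set.Ioo 0 (s i)) (u : Fin d → ℝ) :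
    quantizeParam g lo s (quantizeParam g lo s θ v) u = quantizeParam g lo s θ u := by
  funext j
  by_cases hj : j ∈ Set.range g
  · obtain ⟨i, rfl⟩ := hj
    rw [quantizeParam_secret hg, floor_quantizeParam hg hs θ hv, quantizeParam_secret hg]
  · rw [quantizeParam_nonsecret hj, quantizeParam_nonsecret hj, quantizeParam_nonsecret hj]

/-- The parameter with secrets `p.1` and non-secret coordinates `p.2`. -/
noncomputable def assembleParam (g : Fin d → Fin k ⊕ Fin k)
    (p : (Fin d → ℝ) × ({j // j ∉ Set.range g} → ℝ)) : GaussParam k :=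
  open scoped Classical in
  Function.extend g p.1 fun j => if h : j ∉ Set.range g then p.2 ⟨j, h⟩ else 0

lemma assembleParam_secret (hg : Function.Injective g)
    (p : (Fin d → ℝ) × ({j // j ∉ Set.range g} → ℝ)) (i : Fin d) :
    assembleParam g p (g i) = p.1 i := by
  rw [assembleParam, hg.extend_apply]

lemma assembleParam_nonsecret (p : (Fin d → ℝ) × ({j // j ∉ Set.range g} → ℝ))
    {j : Fin k ⊕ Fin k} (hj : j ∉ Set.range g) : assembleParam g p j = p.2 ⟨j, hj⟩ := by
  rw [assembleParam, Function.extend_apply' _ _ _ (by simpa using hj), dif_pos hj]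

lemma measurable_assembleParam (hg : Function.Injective g) : Measurable (assembleParam g) := by
  refine measurable_pi_lambda _ fun j => ?_
  by_cases hj : j ∈ Set.range g
  · obtain ⟨i, rfl⟩ := hj
    simp only [assembleParam_secret hg]
    fun_prop
  · simp only [assembleParam_nonsecret _ hj]
    fun_prop

lemma UniformSecretsPrior.map_secrets {P : Measure (GaussParam k)} {hi : Fin d → ℝ}
    (hP : UniformSecretsPrior P g lo hi) :
    P.map (fun θ i => θ (g i)) = Measure.pi fun i => cond volume (Set.Icc (lo i) (hi i)) := by
  have := hP.isProbabilityMeasure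
  rw [(iIndepFun_iff_map_fun_eq_pi_map fun i => (measurable_pi_apply (g i)).aemeasurable).1 hP.indep]
  congr 1
  funext i
  exact hP.uniform i

/-- The prior is invariant under the quantization mechanism. -/
theorem UniformSecretsPrior.measurePreserving_quantizeParam (hg : Function.Injective g)
    (hs : ∀ i, 0 < s i) {m : Fin d → ℕ} {P : Measure (GaussParam k)}
    (hP : UniformSecretsPrior P g lo fun i => lo i + m i * s i) :
    MeasurePreserving (fun p : GaussParam k × (Fin d → ℝ) => quantizeParam g lo s p.1 p.2)
      (P.prod (quantizeNoise s)) P := by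
  have := hP.isProbabilityMeasure
  have := isProbabilityMeasure_quantizeNoise hs
  let S : GaussParam k → Fin d → ℝ := fun θ i => θ (g i)
  let R : GaussParam k → {j // j ∉ Set.range g} → ℝ := fun θ j => θ j
  have hS : Measurable S := by fun_prop
  have hR : Measurable R := by fun_prop
  have hSprob : IsProbabilityMeasure (P.map S) := Measure.isProbabilityMeasure_map hS.aemeasurable
  have hRprob : IsProbabilityMeasure (P.map R) := Measure.isProbabilityMeasure_map hR.aemeasurable
  have hE : MeasurePreserving (fun θ => (S θ, R θ)) P ((P.map S).prod (P.map R)) :=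
    ⟨by fun_prop, hP.indep_nonsecret.map_prod_eq_prod_map_map hS.aemeasurable hR.aemeasurable⟩
  -- Independence of secrets and non-secrets makes the prior the image of a product measure, so
  -- resampling can act on the secret factor alone.
  have hΨ : MeasurePreserving (assembleParam g) ((P.map S).prod (P.map R)) P := by
    refine ⟨measurable_assembleParam hg, ?_⟩
    rw [← hE.map_eq, Measure.map_map (measurable_assembleParam hg) (by fun_prop)]
    convert Measure.map_id
    funext θ j
    by_cases hj : j ∈ Set.range g
    · obtain ⟨i, rfl⟩ := hj
      simp [assembleParam_secret hg, S]
    · simp [assembleParam_nonsecret _ hj, R]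
  have hQ := measurePreserving_resample_cells hs lo m
  rw [← hP.map_secrets] at hQ
  have hswap : MeasurePreserving
      (fun q : ((Fin d → ℝ) × ({j // j ∉ Set.range g} → ℝ)) × (Fin d → ℝ) =>
        ((q.1.1, q.2), q.1.2))
      (((P.map S).prod (P.map R)).prod (quantizeNoise s))
      (((P.map S).prod (quantizeNoise s)).prod (P.map R)) :=
    ((measurePreserving_prodAssoc _ _ _).symm).comp
      (((MeasurePreserving.id _).prod Measure.measurePreserving_swap).comp
        (measurePreserving_prodAssoc _ _ _))
  have hall := hΨ.comp ((hQ.prod (MeasurePreserving.id (P.map R))).comp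
    (hswap.comp (hE.prod (MeasurePreserving.id (quantizeNoise s)))))
  convert hall using 1
  funext p j
  by_cases hj : j ∈ Set.range g
  · obtain ⟨i, rfl⟩ := hj
    simp [assembleParam_secret hg, quantizeParam_secret hg, S]
  · simp [assembleParam_nonsecret _ hj, quantizeParam_nonsecret hj, R]

end Prior

/-! ### Union privacy of the quantization mechanism -/

/-- The probability that at least one of finitely many independent events occurs. -/
lemma pi_exists_mem {ι : Type*} [Fintype ι] {α : ι → Type*} [∀ i, MeasurableSpace (α i)]
    (μ : ∀ i, Measure (α i)) [∀ i, IsProbabilityMeasure (μ i)] {B : ∀ i, Set (α i)}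
    (hB : ∀ i, MeasurableSet (B i)) :
    Measure.pi μ {v | ∃ i, v i ∈ B i} = ENNReal.ofReal (1 - ∏ i, (1 - (μ i).real (B i))) := by
  have hm : MeasurableSet (Set.univ.pi fun i => (B i)ᶜ) :=
    MeasurableSet.univ_pi fun i => (hB i).compl
  have e : {v : ∀ i, α i | ∃ i, v i ∈ B i} = (Set.univ.pi fun i => (B i)ᶜ)ᶜ := by
    ext v; simp
  rw [e, ← ofReal_measureReal, probReal_compl_eq_one_sub hm]
  congr 2
  rw [measureReal_def, Measure.pi_pi, ENNReal.toReal_prod]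
  exact Finset.prod_congr rfl fun i _ => probReal_compl_eq_one_sub (hB i)

lemma measurableSet_abs_sub_le (a ε : ℝ) : MeasurableSet {v : ℝ | |a - v| ≤ ε} :=
  measurableSet_le (by fun_prop) measurable_const

lemma setOf_abs_sub_le_eq_Icc (a ε : ℝ) : {v : ℝ | |a - v| ≤ ε} = Set.Icc (a - ε) (a + ε) := by
  ext v
  rw [Set.mem_ofPred_eq, abs_le, Set.mem_Icc]
  constructor <;> rintro ⟨h1, h2⟩ <;> constructor <;> linarith

lemma cond_Ioo_real_abs_sub_le {s ε : ℝ} (hs : 0 < s) (hε : 0 < ε) (a : ℝ) :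
    (cond volume (Set.Ioo 0 s)).real {v | |a - v| ≤ ε} ≤ 2 * ε / s := by
  refine ENNReal.toReal_le_of_le_ofReal (by positivity) ?_
  rw [cond_volume_Ioo_apply, setOf_abs_sub_le_eq_Icc, ENNReal.ofReal_div_of_pos hs,
    ENNReal.div_eq_inv_mul]
  gcongr
  refine (measure_mono Set.inter_subset_right).trans_eq ?_
  rw [Real.volume_Icc]
  congr 1; ring

/-- Equality holds because the window of radius `ε` does not stick out of the interval. This serves
both the midpoint attack and the uniform attack in the lower bound. -/
lemma cond_Ioo_real_abs_sub_le_of_subset {s ε a : ℝ} (hs : 0 < s) (hε : 0 < ε)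
    (h1 : ε ≤ a) (h2 : a + ε ≤ s) :
    (cond volume (Set.Ioo 0 s)).real {v | |a - v| ≤ ε} = 2 * ε / s := by
  have h : volume (Set.Ioo 0 s ∩ {v : ℝ | |a - v| ≤ ε}) = ENNReal.ofReal (2 * ε) := by
    rw [setOf_abs_sub_le_eq_Icc,
      measure_congr ((Ioo_ae_eq_Icc (μ := volume) (a := (0 : ℝ)) (b := s)).inter
        (Filter.EventuallyEq.refl _ (Set.Icc (a - ε) (a + ε)))),
      Set.inter_eq_right.2 (Set.Icc_subset_Icc (by linarith) (by linarith)), Real.volume_Icc]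
    congr 1; ring
  rw [measureReal_def, cond_volume_Ioo_apply, h, ← ENNReal.div_eq_inv_mul,
    ← ENNReal.ofReal_div_of_pos hs, ENNReal.toReal_ofReal (by positivity)]

/-- Let `q` be a randomized map that leaves `P` invariant and such that the law of a second
application does not depend on the outcome of the first. An observer of `q θ u` cannot distinguish
`θ` from an independent second copy `q θ v`. -/
lemma lintegral_kernel_resample {Θ V G : Type*} [MeasurableSpace Θ] [MeasurableSpace V]
    [MeasurableSpace G] {P : Measure Θ} [SFinite P] {N : Measure V} [SFinite N] {q : Θ → V → Θ}
    (hq : MeasurePreserving (fun p : Θ × V => q p.1 p.2) (P.prod N) P)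
    (hqq : ∀ θ, ∀ᵐ v ∂N, ∀ u, q (q θ v) u = q θ u) {R : Θ → Set G}
    (hR : MeasurableSet {p : Θ × G | p.2 ∈ R p.1}) (A : Kernel Θ G) [IsSFiniteKernel A] :
    ∫⁻ θ, ∫⁻ u, A (q θ u) (R θ) ∂N ∂P
      = ∫⁻ θ, ∫⁻ u, ∫⁻ y, N {v | y ∈ R (q θ v)} ∂(A (q θ u)) ∂N ∂P := by
  have hqm := hq.measurable
  have hqθ (θ : Θ) : Measurable (q θ) := hqm.comp measurable_prodMk_left
  have hA : Measurable fun p : Θ × Θ => A p.1 (R p.2) := by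
    have hc : Measurable fun p : (Θ × Θ) × G => (p.1.2, p.2) := by fun_prop
    exact Kernel.measurable_kernel_prodMk_left (κ := A.comap Prod.fst measurable_fst) (hc hR)
  have hH : Measurable fun θ => ∫⁻ u, A (q θ u) (R θ) ∂N :=
    (hA.comp (hqm.prodMk measurable_fst)).lintegral_prod_right'
  rw [← hq.lintegral_comp hH]
  refine (lintegral_prod _ (hH.comp hqm).aemeasurable).trans ?_
  refine lintegral_congr fun θ => ?_
  calc _ = ∫⁻ v, ∫⁻ u, A (q θ u) (R (q θ v)) ∂N ∂N := by
        refine lintegral_congr_ae ?_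
        filter_upwards [hqq θ] with v hv
        refine lintegral_congr fun u => ?_
        change A (q (q θ v) u) (R (q θ v)) = A (q θ u) (R (q θ v))
        rw [hv]
    _ = ∫⁻ u, ∫⁻ v, A (q θ u) (R (q θ v)) ∂N ∂N :=
        lintegral_lintegral_swap (hA.comp (((hqθ θ).comp measurable_snd).prodMk
          ((hqθ θ).comp measurable_fst))).aemeasurable
    _ = _ := by
        refine lintegral_congr fun u => ?_
        have hT : MeasurableSet {p : V × G | p.2 ∈ R (q θ p.1)} :=
          (((hqθ θ).comp measurable_fst).prodMk measurable_snd) hR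
        exact (Measure.prod_apply hT).symm.trans (Measure.prod_apply_symm hT)

section Privacy

variable {k d : ℕ} {g : Fin d → Fin k ⊕ Fin k} {lo s ε : Fin d → ℝ}

/-- The success probability of an attack on the quantization mechanism: given the released
parameter, every secret is uniformly distributed in its cell. -/
lemma lintegral_attack_quantizationMechanism (hg : Function.Injective g) (hs : ∀ i, 0 < s i)
    {m : Fin d → ℕ} {P : Measure (GaussParam k)}
    (hP : UniformSecretsPrior P g lo fun i => lo i + m i * s i)
    (A : Kernel (GaussParam k) (Fin d → ℝ)) [IsMarkovKernel A] :
    ∫⁻ θ, ∫⁻ θ', A θ' {guess | ∃ i, |guess i - θ (g i)| ≤ ε i}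
        ∂(quantizationMechanism g lo s θ) ∂P
      = ∫⁻ θ, ∫⁻ u, ∫⁻ guess,
          quantizeNoise s {v | ∃ i, |guess i - quantizeParam g lo s θ v (g i)| ≤ ε i}
          ∂(A (quantizeParam g lo s θ u)) ∂(quantizeNoise s) ∂P := by
  have := hP.isProbabilityMeasure
  have := isProbabilityMeasure_quantizeNoise hs
  have hq := measurable_quantizeParam g lo s
  have hqθ (θ : GaussParam k) : Measurable (quantizeParam g lo s θ) :=
    Measurable.of_uncurry_left (f := quantizeParam g lo s) hq
  have hset : MeasurableSet {p : GaussParam k × (Fin d → ℝ) | ∃ i, |p.2 i - p.1 (g i)| ≤ ε i} := by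
    simp only [Set.ofPred_exists]
    exact MeasurableSet.iUnion fun i => measurableSet_le (by fun_prop) measurable_const
  have hsetθ (θ : GaussParam k) :
      MeasurableSet {guess : Fin d → ℝ | ∃ i, |guess i - θ (g i)| ≤ ε i} :=
    measurable_prodMk_left hset
  have h1 (θ : GaussParam k) := lintegral_map (μ := quantizeNoise s)
    (Kernel.measurable_coe A (hsetθ θ)) (hqθ θ)
  refine (lintegral_congr h1).trans ?_
  exact lintegral_kernel_resample (hP.measurePreserving_quantizeParam hg hs)
    (fun θ => (ae_quantizeNoise_mem hs).mono fun v hv u =>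
      quantizeParam_quantizeParam hg hs θ hv u) hset A

lemma quantizeNoise_exists_abs_sub_le (hg : Function.Injective g) (hs : ∀ i, 0 < s i)
    (θ : GaussParam k) (guess : Fin d → ℝ) :
    quantizeNoise s {v | ∃ i, |guess i - quantizeParam g lo s θ v (g i)| ≤ ε i}
      = ENNReal.ofReal (1 - ∏ i, (1 - (cond volume (Set.Ioo 0 (s i))).real
          {v | |(guess i - (lo i + ⌊(θ (g i) - lo i) / s i⌋ * s i)) - v| ≤ ε i})) := by
  have (i : Fin d) := isProbabilityMeasure_cond_Ioo (hs i)
  rw [quantizeNoise, ← pi_exists_mem _ fun i => measurableSet_abs_sub_le _ _]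
  simp_rw [quantizeParam_secret hg, Set.mem_ofPred_eq, sub_sub]

theorem unionPrivacy_quantizationMechanism (hg : Function.Injective g) (hε : ∀ i, 0 < ε i)
    (hεs : ∀ i, 2 * ε i < s i) {m : Fin d → ℕ} {P : Measure (GaussParam k)}
    (hP : UniformSecretsPrior P g lo fun i => lo i + m i * s i) :
    unionPrivacy P g ε (quantizationMechanism g lo s)
      = ENNReal.ofReal (1 - ∏ i, (1 - 2 * ε i / s i)) := by
  have hs (i : Fin d) : 0 < s i := by linarith [hε i, hεs i]
  have := hP.isProbabilityMeasure
  have := isProbabilityMeasure_quantizeNoise hs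
  refine le_antisymm (iSup₂_le fun A hA => ?_) ?_
  · rw [lintegral_attack_quantizationMechanism hg hs hP]
    calc _ ≤ ∫⁻ θ, ∫⁻ u, ∫⁻ _, ENNReal.ofReal (1 - ∏ i, (1 - 2 * ε i / s i))
          ∂(A (quantizeParam g lo s θ u)) ∂(quantizeNoise s) ∂P := by
          refine lintegral_mono fun θ => lintegral_mono fun u => lintegral_mono fun guess => ?_
          rw [quantizeNoise_exists_abs_sub_le hg hs]
          refine ENNReal.ofReal_le_ofReal (sub_le_sub_left
            (Finset.prod_le_prod (fun i _ => ?_) fun i _ => ?_) _)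
          · rw [sub_nonneg, div_le_one (hs i)]
            exact (hεs i).le
          · exact sub_le_sub_left (cond_Ioo_real_abs_sub_le (hs i) (hε i) _) _
      _ = _ := by simp
  -- The optimal attack guesses the midpoint of the observed cell; since `2 εᵢ < sᵢ`, the tolerance
  -- window fits inside the cell.
  · have hmid : Measurable fun (θ' : GaussParam k) (i : Fin d) =>
        lo i + ⌊(θ' (g i) - lo i) / s i⌋ * s i + s i / 2 := by fun_prop
    refine le_iSup₂_of_le (Kernel.deterministic _ hmid) inferInstance ?_
    rw [lintegral_attack_quantizationMechanism hg hs hP]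
    have h : ∀ θ, ∀ᵐ u ∂quantizeNoise s, ENNReal.ofReal (1 - ∏ i, (1 - 2 * ε i / s i)) =
        ∫⁻ guess, quantizeNoise s {v | ∃ i, |guess i - quantizeParam g lo s θ v (g i)| ≤ ε i}
          ∂(Kernel.deterministic _ hmid (quantizeParam g lo s θ u)) := by
      intro θ
      filter_upwards [ae_quantizeNoise_mem hs] with u hu
      rw [Kernel.deterministic_apply]
      simp_rw [floor_quantizeParam hg hs θ hu]
      rw [lintegral_dirac, quantizeNoise_exists_abs_sub_le hg hs]
      congr 2
      refine Finset.prod_congr rfl fun i _ => ?_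
      rw [cond_Ioo_real_abs_sub_le_of_subset (hs i) (hε i)] <;> linarith [hεs i]
    rw [lintegral_congr fun θ => (lintegral_congr_ae (h θ)).symm]
    simp

end Privacy

/-! ### Distortion of the quantization mechanism -/

section Distortion

variable {k d : ℕ} {g : Fin d → Fin k ⊕ Fin k} {lo s : Fin d → ℝ}

/-- The support of the prior contains parameters all of whose secrets are close to the left
endpoints of their ranges. -/
lemma UniformSecretsPrior.exists_mem_support {hi : Fin d → ℝ} {P : Measure (GaussParam k)}
    (hP : UniformSecretsPrior P g lo hi) (hlohi : ∀ i, lo i < hi i) {δ : ℝ} (hδ : 0 < δ) :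
    ∃ θ ∈ P.support, ∀ i, θ (g i) ∈ Set.Icc (lo i) (lo i + δ) := by
  have hmeas : MeasurableSet (Set.univ.pi fun i => Set.Icc (lo i) (lo i + δ)) :=
    MeasurableSet.univ_pi fun i => measurableSet_Icc
  have hpos : 0 < P ((fun θ i => θ (g i)) ⁻¹' Set.univ.pi fun i => Set.Icc (lo i) (lo i + δ)) := by
    rw [← Measure.map_apply (by fun_prop) hmeas, hP.map_secrets, Measure.pi_pi,
      CanonicallyOrderedAdd.prod_pos]
    intro i _
    rw [cond_apply measurableSet_Icc, Set.Icc_inter_Icc, Real.volume_Icc, Real.volume_Icc]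
    refine ENNReal.mul_pos (by simp) ?_
    simp [hlohi i, hδ]
  obtain ⟨θ, hθ, hθP⟩ := Measure.nonempty_inter_support_of_pos hpos
  exact ⟨θ, hθP, fun i => hθ i trivial⟩

lemma UniformSecretsPrior.sd_nonneg_of_mem_support {hi : Fin d → ℝ} {P : Measure (GaussParam k)}
    (hP : UniformSecretsPrior P g lo hi) {θ : GaussParam k} (hθ : θ ∈ P.support) (j : Fin k) :
    0 ≤ θ (Sum.inr j) :=
  Measure.support_subset_of_isClosed (t := {θ : GaussParam k | 0 ≤ θ (Sum.inr j)})
    (isClosed_le continuous_const (continuous_apply _)) (hP.sd_nonneg.mono fun _ h => h j) hθ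

lemma UniformSecretsPrior.le_of_mem_support {hi : Fin d → ℝ} {P : Measure (GaussParam k)}
    (hP : UniformSecretsPrior P g lo hi) {θ : GaussParam k} (hθ : θ ∈ P.support)
    (i : Fin d) : lo i ≤ θ (g i) := by
  refine Measure.support_subset_of_isClosed (t := {θ : GaussParam k | lo i ≤ θ (g i)})
    (isClosed_le continuous_const (continuous_apply _)) ?_ hθ
  have h : ∀ᵐ x ∂P.map (fun θ : GaussParam k => θ (g i)), lo i ≤ x := by
    rw [show P.map (fun θ : GaussParam k => θ (g i)) = _ from hP.uniform i]
    exact (ae_cond_mem measurableSet_Icc).mono fun x hx => hx.1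
  exact ae_of_ae_map (measurable_pi_apply (g i)).aemeasurable h

/-- Support points have this coordinate arbitrarily close to `lo i`, and it is a nonnegative
standard deviation. It follows that released standard deviations are nonnegative, as the exact `W₂`
formula requires. -/
lemma UniformSecretsPrior.lo_nonneg {hi : Fin d → ℝ} {P : Measure (GaussParam k)}
    (hP : UniformSecretsPrior P g lo hi) (hlohi : ∀ i, lo i < hi i) {i : Fin d} {j : Fin k}
    (hij : g i = Sum.inr j) : 0 ≤ lo i := by
  refine le_of_forall_pos_le_add fun δ hδ => ?_
  obtain ⟨θ, hθ, h⟩ := hP.exists_mem_support hlohi hδ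
  have h0 := hP.sd_nonneg_of_mem_support hθ j
  rw [← hij] at h0
  exact h0.trans (h i).2

/-- The released parameter agrees with the original one outside the secrets, and its secrets lie in
the closed cells of the original secrets. -/
lemma mem_support_quantizationMechanism (hg : Function.Injective g) (hs : ∀ i, 0 < s i)
    {θ θ' : GaussParam k} (hθ' : θ' ∈ (quantizationMechanism g lo s θ).support) :
    (∀ i, θ' (g i) ∈ Set.Icc (lo i + ⌊(θ (g i) - lo i) / s i⌋ * s i)
      (lo i + ⌊(θ (g i) - lo i) / s i⌋ * s i + s i)) ∧ ∀ j ∉ Set.range g, θ' j = θ j := by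
  have hqθ : Measurable (quantizeParam g lo s θ) :=
    Measurable.of_uncurry_left (f := quantizeParam g lo s) (measurable_quantizeParam g lo s)
  have key (t : Set (GaussParam k)) (ht : IsClosed t)
      (h : ∀ u : Fin d → ℝ, (∀ i, u i ∈ Set.Ioo 0 (s i)) → quantizeParam g lo s θ u ∈ t) :
      θ' ∈ t := by
    refine Measure.support_subset_of_isClosed ht ?_ hθ'
    exact (ae_map_iff hqθ.aemeasurable ht.measurableSet).2
      ((ae_quantizeNoise_mem hs).mono fun u hu => h u hu)
  refine ⟨fun i => key {θ' | θ' (g i) ∈ Set.Icc _ _}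
    (isClosed_Icc.preimage (continuous_apply (g i))) fun u hu => ?_,
    fun j hj => key {θ' | θ' j = θ j} (isClosed_eq (continuous_apply j) continuous_const)
      fun u _ => quantizeParam_nonsecret hj θ u⟩
  rw [Set.mem_ofPred_eq, quantizeParam_secret hg]
  exact ⟨by linarith [(hu i).1], by linarith [(hu i).2]⟩

lemma exists_mem_support_quantizationMechanism (hg : Function.Injective g) (hs : ∀ i, 0 < s i)
    (θ : GaussParam k) {δ : ℝ} (hδ : 0 < δ) :
    ∃ θ' ∈ (quantizationMechanism g lo s θ).support, ∀ i,
      lo i + ⌊(θ (g i) - lo i) / s i⌋ * s i + (s i - δ) ≤ θ' (g i) := by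
  have hqθ : Measurable (quantizeParam g lo s θ) :=
    Measurable.of_uncurry_left (f := quantizeParam g lo s) (measurable_quantizeParam g lo s)
  have (i : Fin d) := isProbabilityMeasure_cond_Ioo (hs i)
  have hmeas : MeasurableSet {θ' : GaussParam k | ∀ i,
      lo i + ⌊(θ (g i) - lo i) / s i⌋ * s i + (s i - δ) ≤ θ' (g i)} := by
    simp only [Set.ofPred_forall]
    exact MeasurableSet.iInter fun i => measurableSet_le measurable_const (measurable_pi_apply _)
  have hpos : 0 < quantizationMechanism g lo s θ {θ' : GaussParam k | ∀ i,
      lo i + ⌊(θ (g i) - lo i) / s i⌋ * s i + (s i - δ) ≤ θ' (g i)} := by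
    change 0 < (quantizeNoise s).map (quantizeParam g lo s θ) _
    rw [Measure.map_apply hqθ hmeas]
    have e : quantizeParam g lo s θ ⁻¹' {θ' : GaussParam k | ∀ i,
        lo i + ⌊(θ (g i) - lo i) / s i⌋ * s i + (s i - δ) ≤ θ' (g i)}
        = Set.univ.pi fun i => Set.Ici (s i - δ) := by
      ext u
      simp [quantizeParam_secret hg, Pi.le_def]
    rw [e, quantizeNoise, Measure.pi_pi, CanonicallyOrderedAdd.prod_pos]
    intro i _
    rw [cond_volume_Ioo_apply]
    refine ENNReal.mul_pos (by simp) (ne_of_gt ?_)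
    refine lt_of_lt_of_le ?_ (measure_mono (s := Set.Ioo (max 0 (s i - δ)) (s i)) fun x hx =>
      ⟨⟨(le_max_left _ _).trans_lt hx.1, hx.2⟩, (le_max_right _ _).trans hx.1.le⟩)
    simp [hs i, hδ]
  obtain ⟨θ', h, hθ'⟩ := Measure.nonempty_inter_support_of_pos hpos
  exact ⟨θ', hθ', h⟩

lemma floor_cell_bounds {s : ℝ} (hs : 0 < s) (lo x : ℝ) :
    lo + ⌊(x - lo) / s⌋ * s ≤ x ∧ x ≤ lo + ⌊(x - lo) / s⌋ * s + s := by
  have h1 := (le_div_iff₀ hs).1 (Int.floor_le ((x - lo) / s))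
  have h2 := (div_lt_iff₀ hs).1 (Int.lt_floor_add_one ((x - lo) / s))
  constructor <;> linarith

theorem distortion_quantizationMechanism (hg : Function.Injective g) (hs : ∀ i, 0 < s i)
    {m : Fin d → ℕ} (hm : ∀ i, 0 < m i) {P : Measure (GaussParam k)}
    (hP : UniformSecretsPrior P g lo fun i => lo i + m i * s i) :
    distortion P (quantizationMechanism g lo s) = ENNReal.ofReal √(∑ i, s i ^ 2) := by
  have hlohi (i : Fin d) : lo i < lo i + m i * s i := by
    have := mul_pos (Nat.cast_pos (α := ℝ).2 (hm i)) (hs i)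
    linarith
  have hW {θ θ' : GaussParam k} (hθ : θ ∈ P.support)
      (hθ' : θ' ∈ (quantizationMechanism g lo s θ).support) :
      wasserstein2 (gaussLaw θ) (gaussLaw θ')
        = ENNReal.ofReal √(∑ i, (θ (g i) - θ' (g i)) ^ 2) := by
    obtain ⟨h1, h2⟩ := mem_support_quantizationMechanism hg hs hθ'
    rw [wasserstein2_gaussLaw (hP.sd_nonneg_of_mem_support hθ)]
    · congr 2
      refine (Fintype.sum_of_injective g hg _ _ (fun j hj => ?_) fun i => rfl).symm
      rw [h2 j hj, sub_self, zero_pow two_ne_zero]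
    · intro j
      by_cases hj : Sum.inr j ∈ Set.range g
      · obtain ⟨i, hi⟩ := hj
        rw [← hi]
        have hfl : (0 : ℝ) ≤ ⌊(θ (g i) - lo i) / s i⌋ := by
          exact_mod_cast Int.floor_nonneg.2
            (div_nonneg (sub_nonneg.2 (hP.le_of_mem_support hθ i)) (hs i).le)
        exact (add_nonneg (hP.lo_nonneg hlohi hi) (mul_nonneg hfl (hs i).le)).trans (h1 i).1
      · rw [h2 _ hj]
        exact hP.sd_nonneg_of_mem_support hθ j
  refine le_antisymm (iSup₂_le fun θ hθ => iSup₂_le fun θ' hθ' => ?_) ?_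
  · rw [hW hθ hθ']
    refine ENNReal.ofReal_le_ofReal (Real.sqrt_le_sqrt (Finset.sum_le_sum fun i _ => ?_))
    have h1 := (mem_support_quantizationMechanism hg hs hθ').1 i
    have h2 := floor_cell_bounds (hs i) (lo i) (θ (g i))
    exact sq_le_sq' (by linarith [h1.2, h2.1]) (by linarith [h1.1, h2.2])
  -- The supremum is approached by originals within `δ` of the left endpoints and releases within
  -- `δ` of the right ends of their cells: each secret then moves by at least `s i - 2 * δ`.
  · have hlim : Filter.Tendsto (fun δ : ℝ => ENNReal.ofReal √(∑ i, (s i - 2 * δ) ^ 2))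
        (nhdsWithin 0 (Set.Ioi 0)) (nhds (ENNReal.ofReal √(∑ i, s i ^ 2))) := by
      have hc : Continuous fun δ : ℝ => ENNReal.ofReal √(∑ i, (s i - 2 * δ) ^ 2) :=
        ENNReal.continuous_ofReal.comp (by fun_prop)
      have := hc.tendsto 0
      simp only [mul_zero, sub_zero] at this
      exact this.mono_left nhdsWithin_le_nhds
    refine le_of_tendsto hlim ?_
    have hsmall : ∀ᶠ δ : ℝ in nhdsWithin 0 (Set.Ioi 0), ∀ i, 2 * δ < s i := by
      rw [Filter.eventually_all]
      intro i
      refine nhdsWithin_le_nhds ((by fun_prop : Continuous fun δ : ℝ => 2 * δ).tendsto' 0 0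
        (by simp) |>.eventually (gt_mem_nhds (hs i)))
    filter_upwards [hsmall, self_mem_nhdsWithin] with δ hδs hδ
    rw [Set.mem_Ioi] at hδ
    obtain ⟨θ, hθ, h1⟩ := hP.exists_mem_support hlohi hδ
    obtain ⟨θ', hθ', h2⟩ := exists_mem_support_quantizationMechanism (lo := lo) hg hs θ hδ
    refine le_trans ?_ (le_iSup₂_of_le θ hθ (le_iSup₂ (f := fun θ' (_ : θ' ∈
      (quantizationMechanism g lo s θ).support) => wasserstein2 (gaussLaw θ) (gaussLaw θ')) θ' hθ'))
    rw [hW hθ hθ']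
    refine ENNReal.ofReal_le_ofReal (Real.sqrt_le_sqrt (Finset.sum_le_sum fun i _ => ?_))
    have h3 := h2 i
    have hfl : (0 : ℝ) ≤ ⌊(θ (g i) - lo i) / s i⌋ := by
      exact_mod_cast Int.floor_nonneg.2
        (div_nonneg (sub_nonneg.2 (h1 i).1) (hs i).le)
    have h4 := mul_nonneg hfl (hs i).le
    rw [← neg_sq (θ (g i) - _)]
    exact pow_le_pow_left₀ (by linarith [hδs i]) (by linarith [(h1 i).2]) 2

end Distortion

/-! ### Lower bound for the distortion of an arbitrary mechanism -/

lemma ratio_bounds {d : ℕ} (hd : 0 < d) {ε s : Fin d → ℝ} (hε : ∀ i, 0 < ε i)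
    (hεs : ∀ i, 2 * ε i < s i) :
    0 < (⨅ i, ε i / s i) ∧ 0 < (⨆ i, ε i / s i) ∧ 2 * (⨆ i, ε i / s i) < 1 := by
  have hne : Nonempty (Fin d) := ⟨⟨0, hd⟩⟩
  have hs (i : Fin d) : 0 < s i := by linarith [hε i, hεs i]
  obtain ⟨i, hi⟩ := exists_eq_ciInf_of_finite (f := fun i => ε i / s i)
  obtain ⟨j, hj⟩ := exists_eq_ciSup_of_finite (f := fun i => ε i / s i)
  rw [← hi, ← hj]
  refine ⟨div_pos (hε i) (hs i), div_pos (hε j) (hs j), ?_⟩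
  rw [← mul_div_assoc, div_lt_one (hs j)]
  exact hεs j

lemma tradeoffConst_pos {d : ℕ} (hd : 0 < d) {ε s : Fin d → ℝ} (hε : ∀ i, 0 < ε i)
    (hεs : ∀ i, 2 * ε i < s i) : 0 < tradeoffConst ε s := by
  obtain ⟨h1, h2, h3⟩ := ratio_bounds hd hε hεs
  have hG : 0 < (∏ i, ε i) ^ (1 / d : ℝ) :=
    Real.rpow_pos_of_pos (Finset.prod_pos fun i _ => hε i) _
  have hn : 0 < √(∑ i, ε i ^ 2) :=
    Real.sqrt_pos.2 (Finset.sum_pos (fun i _ => pow_pos (hε i) 2) ⟨⟨0, hd⟩, Finset.mem_univ _⟩)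
  have h4 : 0 < 1 - 2 * ⨆ i, ε i / s i := by linarith
  rw [tradeoffConst]
  positivity

/-- If `∏ (1 - 2 εᵢ / sᵢ) ≤ ∏ r / (r + εᵢ)` then `r` is at least a multiple of the Euclidean norm
of `s`. -/
lemma sqrt_sum_sq_le_tradeoffConst_mul {d : ℕ} (hd : 0 < d) {ε s : Fin d → ℝ} (hε : ∀ i, 0 < ε i)
    (hεs : ∀ i, 2 * ε i < s i) {r : ℝ} (hr : 0 ≤ r)
    (h : ∏ i, (1 - 2 * ε i / s i) ≤ ∏ i, r / (r + ε i)) :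
    √(∑ i, s i ^ 2) ≤ tradeoffConst ε s * r := by
  have hs (i : Fin d) : 0 < s i := by linarith [hε i, hεs i]
  have ht (i : Fin d) : 0 < r + ε i := by linarith [hε i]
  have hdR : (d : ℝ) ≠ 0 := by exact_mod_cast hd.ne'
  obtain ⟨hc₁pos, hc₂pos, hc₂lt⟩ := ratio_bounds hd hε hεs
  set c₁ := ⨅ i, ε i / s i
  set c₂ := ⨆ i, ε i / s i
  have hc₁le (i : Fin d) : c₁ ≤ ε i / s i := ciInf_le (Set.finite_range _).bddBelow i
  have hlec₂ (i : Fin d) : ε i / s i ≤ c₂ :=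
    le_ciSup (f := fun i => ε i / s i) (Set.finite_range _).bddAbove i
  set G := (∏ i, ε i) ^ (1 / d : ℝ) with hG
  have hGpos : 0 < G := Real.rpow_pos_of_pos (Finset.prod_pos fun i _ => hε i) _
  have hamgm (z : Fin d → ℝ) (hz : ∀ i, 0 ≤ z i) :
      (∏ i, z i) ^ (1 / d : ℝ) ≤ ∑ i, (1 / d : ℝ) * z i := by
    rw [← Real.finsetProd_rpow _ _ fun i _ => hz i]
    refine Real.geom_mean_le_arith_mean_weighted _ _ _ (fun _ _ => by positivity) ?_ fun i _ => hz i
    simp [hdR]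
  set X := (∏ i, r / (r + ε i)) ^ (1 / d : ℝ) with hX
  set Y := (∏ i, ε i / (r + ε i)) ^ (1 / d : ℝ) with hY
  -- The fractions `r / (r + εᵢ)` and `εᵢ / (r + εᵢ)` sum to `1`, hence so do their arithmetic
  -- means, which dominate `X` and `Y`.
  have hXY : X + Y ≤ 1 := by
    refine (add_le_add (hamgm _ fun i => div_nonneg hr (ht i).le)
      (hamgm _ fun i => div_nonneg (hε i).le (ht i).le)).trans_eq ?_
    rw [← Finset.sum_add_distrib]
    have e (i : Fin d) : (1 / d : ℝ) * (r / (r + ε i)) + (1 / d : ℝ) * (ε i / (r + ε i)) = 1 / d := by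
      rw [← mul_add, ← add_div, div_self (ht i).ne', mul_one]
    rw [Finset.sum_congr rfl fun i _ => e i]
    simp [hdR]
  have hGX : G * X = r * Y := by
    rw [hG, hX, hY, ← Real.mul_rpow (Finset.prod_nonneg fun i _ => (hε i).le)
      (Finset.prod_nonneg fun i _ => div_nonneg hr (ht i).le), ← Finset.prod_mul_distrib]
    have e : ∏ i, ε i * (r / (r + ε i)) = r ^ d * ∏ i, ε i / (r + ε i) := by
      have : r ^ d = ∏ _i : Fin d, r := by simp
      rw [this, ← Finset.prod_mul_distrib]
      exact Finset.prod_congr rfl fun i _ => by ring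
    rw [e, Real.mul_rpow (by positivity)
      (Finset.prod_nonneg fun i _ => div_nonneg (hε i).le (ht i).le), one_div,
      Real.pow_rpow_inv_natCast hr hd.ne']
  have hXge : 1 - 2 * c₂ ≤ X := by
    have h1 : (1 - 2 * c₂) ^ d ≤ ∏ i, r / (r + ε i) := by
      refine le_trans ?_ h
      have : (1 - 2 * c₂) ^ d = ∏ _i : Fin d, (1 - 2 * c₂) := by simp
      rw [this]
      refine Finset.prod_le_prod (fun _ _ => by linarith) fun i _ => ?_
      rw [mul_div_assoc]
      linarith [hlec₂ i]
    have h2 := Real.rpow_le_rpow (pow_nonneg (by linarith) d) h1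
      (by positivity : (0 : ℝ) ≤ 1 / d)
    rwa [one_div, Real.pow_rpow_inv_natCast (by linarith) hd.ne', ← one_div] at h2
  -- Chain: `(1 - 2 c₂) G ≤ G X = r Y ≤ r (1 - X) ≤ 2 c₂ r`.
  have hkey : (1 - 2 * c₂) * G ≤ 2 * c₂ * r := by nlinarith
  -- Termwise, `c₁ sᵢ ≤ εᵢ`.
  have hnorm : c₁ * √(∑ i, s i ^ 2) ≤ √(∑ i, ε i ^ 2) := by
    rw [← Real.sqrt_sq hc₁pos.le, ← Real.sqrt_mul (sq_nonneg _), Finset.mul_sum]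
    refine Real.sqrt_le_sqrt (Finset.sum_le_sum fun i _ => ?_)
    rw [← mul_pow]
    exact pow_le_pow_left₀ (mul_nonneg hc₁pos.le (hs i).le) ((le_div_iff₀ (hs i)).1 (hc₁le i)) 2
  have h12 : 0 < 1 - 2 * c₂ := by linarith
  have hC : tradeoffConst ε s
      = √(∑ i, ε i ^ 2) / G * (2 * c₂ / (c₁ * (1 - 2 * c₂))) := rfl
  have e : tradeoffConst ε s * r
      = (√(∑ i, ε i ^ 2) * (2 * c₂ * r)) / (c₁ * ((1 - 2 * c₂) * G)) := by
    rw [hC]; field_simp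
  rw [e, le_div_iff₀ (by positivity), mul_comm, mul_right_comm]
  exact mul_le_mul hnorm hkey (by positivity) (Real.sqrt_nonneg _)

section LowerBound

variable {k d : ℕ}

/-- The parameter vector with standard deviations made nonnegative. -/
def absSd (θ : GaussParam k) : GaussParam k :=
  Sum.elim (fun j => θ (Sum.inl j)) fun j => |θ (Sum.inr j)|

lemma measurable_absSd_apply (j : Fin k ⊕ Fin k) : Measurable fun θ : GaussParam k => absSd θ j := by
  cases j <;> simp only [absSd, Sum.elim_inl, Sum.elim_inr] <;> fun_prop

lemma gaussDistSq_eq (θ θ' : GaussParam k) :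
    gaussDistSq θ θ' = ∑ j, (absSd θ j - absSd θ' j) ^ 2 := by
  simp [gaussDistSq, Finset.sum_add_distrib, absSd]

/-- The attack that guesses every secret uniformly at random in the interval of radius `r + ε i`
around the released value. -/
noncomputable def uniformAttack (g : Fin d → Fin k ⊕ Fin k) (ε : Fin d → ℝ) (r : ℝ) :
    Kernel (GaussParam k) (Fin d → ℝ) :=
  (Kernel.id ×ₖ Kernel.const (GaussParam k) (quantizeNoise fun i => 2 * (r + ε i))).map
    fun p i => absSd p.1 (g i) - (r + ε i) + p.2 i

variable {g : Fin d → Fin k ⊕ Fin k} {ε : Fin d → ℝ} {r : ℝ}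

lemma measurable_uniformAttack_fun :
    Measurable fun (p : GaussParam k × (Fin d → ℝ)) i => absSd p.1 (g i) - (r + ε i) + p.2 i :=
  measurable_pi_lambda _ fun i =>
    (((measurable_absSd_apply (g i)).comp measurable_fst).sub_const _).add
      ((measurable_pi_apply i).comp measurable_snd)

lemma isMarkovKernel_uniformAttack (hε : ∀ i, 0 < ε i) (hr : 0 ≤ r) :
    IsMarkovKernel (uniformAttack g ε r) := by
  have := isProbabilityMeasure_quantizeNoise (s := fun i => 2 * (r + ε i))
    fun i => by linarith [hε i]
  exact Kernel.IsMarkovKernel.map _ measurable_uniformAttack_fun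

/-- The window of radius `ε i` around the secret lies inside the guessing interval of length `2 (r +
ε i)`, so the miss probability is `r / (r + ε i)` wherever the secret sits; independent misses
multiply. -/
lemma uniformAttack_apply (hε : ∀ i, 0 < ε i) (hr : 0 ≤ r) {θ θ' : GaussParam k}
    (h : ∀ i, |θ (g i) - absSd θ' (g i)| ≤ r) :
    uniformAttack g ε r θ' {guess | ∃ i, |guess i - θ (g i)| ≤ ε i}
      = ENNReal.ofReal (1 - ∏ i, r / (r + ε i)) := by
  have hs (i : Fin d) : 0 < 2 * (r + ε i) := by linarith [hε i]
  have := isProbabilityMeasure_quantizeNoise hs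
  have (i : Fin d) := isProbabilityMeasure_cond_Ioo (hs i)
  have hset : MeasurableSet {guess : Fin d → ℝ | ∃ i, |guess i - θ (g i)| ≤ ε i} := by
    simp only [Set.ofPred_exists]
    exact MeasurableSet.iUnion fun i => measurableSet_le (by fun_prop) measurable_const
  rw [uniformAttack, Kernel.map_apply' _ measurable_uniformAttack_fun _ hset,
    Kernel.prod_apply, Kernel.id_apply, Kernel.const_apply, Measure.dirac_prod,
    Measure.map_apply measurable_prodMk_left (measurable_uniformAttack_fun hset)]
  have e : Prod.mk θ' ⁻¹' ((fun (p : GaussParam k × (Fin d → ℝ)) i =>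
        absSd p.1 (g i) - (r + ε i) + p.2 i) ⁻¹' {guess | ∃ i, |guess i - θ (g i)| ≤ ε i})
      = {u | ∃ i, u i ∈ {v | |(θ (g i) - absSd θ' (g i) + (r + ε i)) - v| ≤ ε i}} := by
    ext u
    simp only [Set.mem_preimage, Set.mem_ofPred_eq]
    refine exists_congr fun i => ?_
    rw [abs_sub_comm]
    ring_nf
  rw [e, quantizeNoise, pi_exists_mem _ fun i => measurableSet_abs_sub_le _ _]
  congr 2
  refine Finset.prod_congr rfl fun i _ => ?_
  have h2 := abs_le.1 (h i)
  rw [cond_Ioo_real_abs_sub_le_of_subset (hs i) (hε i) (by linarith) (by linarith)]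
  have : r + ε i ≠ 0 := by linarith [hε i]
  field_simp
  ring

theorem le_distortion_of_unionPrivacy_le (hd : 0 < d) {s : Fin d → ℝ}
    (hε : ∀ i, 0 < ε i) (hεs : ∀ i, 2 * ε i < s i) {P : Measure (GaussParam k)}
    [IsProbabilityMeasure P] (hsd : ∀ᵐ θ ∂P, ∀ j, 0 ≤ θ (Sum.inr j))
    (M : Kernel (GaussParam k) (GaussParam k)) [IsMarkovKernel M]
    (hM : unionPrivacy P g ε M ≤ ENNReal.ofReal (1 - ∏ i, (1 - 2 * ε i / s i))) :
    ENNReal.ofReal (√(∑ i, s i ^ 2) / tradeoffConst ε s) ≤ distortion P M := by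
  have hs (i : Fin d) : 0 < s i := by linarith [hε i, hεs i]
  by_cases htop : distortion P M = ⊤
  · simp [htop]
  set r := (distortion P M).toReal with hrdef
  have hr : 0 ≤ r := ENNReal.toReal_nonneg
  have hD : distortion P M = ENNReal.ofReal r := (ENNReal.ofReal_toReal htop).symm
  -- Supports have full measure, so the worst-case bound holds almost surely, and a single
  -- coordinate difference is at most the Euclidean distance.
  have hclose : ∀ᵐ θ ∂P, ∀ᵐ θ' ∂(M θ), ∀ j, |θ j - absSd θ' j| ≤ r := by
    filter_upwards [Measure.support_mem_ae (μ := P), hsd] with θ hθ hθ0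
    filter_upwards [Measure.support_mem_ae (μ := M θ)] with θ' hθ' j
    have h1 : ENNReal.ofReal √(gaussDistSq θ θ') ≤ ENNReal.ofReal r := by
      refine (le_wasserstein2_gaussLaw θ θ').trans ?_
      rw [← hD]
      exact le_iSup₂_of_le θ hθ (le_iSup₂ (f := fun θ' (_ : θ' ∈ (M θ).support) =>
        wasserstein2 (gaussLaw θ) (gaussLaw θ')) θ' hθ')
    rw [ENNReal.ofReal_le_ofReal_iff hr] at h1
    have h2 : absSd θ = θ := by
      funext j
      cases j <;> simp [absSd, abs_of_nonneg (hθ0 _)]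
    refine le_trans (Real.le_sqrt_of_sq_le ?_) h1
    rw [gaussDistSq_eq, h2, sq_abs]
    exact Finset.single_le_sum (f := fun j => (θ j - absSd θ' j) ^ 2) (fun _ _ => sq_nonneg _)
      (Finset.mem_univ j)
  have hprod : ∏ i, (1 - 2 * ε i / s i) ≤ ∏ i, r / (r + ε i) := by
    have h1 : ENNReal.ofReal (1 - ∏ i, r / (r + ε i))
        ≤ ENNReal.ofReal (1 - ∏ i, (1 - 2 * ε i / s i)) := by
      refine le_trans ?_ hM
      refine le_iSup₂_of_le (uniformAttack g ε r) (isMarkovKernel_uniformAttack hε hr) ?_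
      calc ENNReal.ofReal (1 - ∏ i, r / (r + ε i))
          = ∫⁻ θ, ∫⁻ _, ENNReal.ofReal (1 - ∏ i, r / (r + ε i)) ∂(M θ) ∂P := by simp
        _ ≤ _ := by
          refine lintegral_mono_ae ?_
          filter_upwards [hclose] with θ hθ
          refine lintegral_mono_ae ?_
          filter_upwards [hθ] with θ' hθ'
          rw [uniformAttack_apply hε hr fun i => hθ' (g i)]
    -- Truncation at `0` loses nothing here, because the right-hand side is nonnegative.
    rw [ENNReal.ofReal_le_ofReal_iff] at h1
    · linarith
    · rw [sub_nonneg]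
      refine Finset.prod_le_one (fun i _ => ?_) fun i _ => ?_
      · rw [sub_nonneg, div_le_one (hs i)]
        exact (hεs i).le
      · have := div_pos (mul_pos two_pos (hε i)) (hs i)
        linarith
  rw [hD]
  refine ENNReal.ofReal_le_ofReal ?_
  rw [div_le_iff₀ (tradeoffConst_pos hd hε hεs), mul_comm]
  exact sqrt_sum_sq_le_tradeoffConst_mul hd hε hεs hr hprod

end LowerBound

theorem mainTheorem5 {k d : ℕ} (hd : 0 < d)
    (g : Fin d → Fin k ⊕ Fin k) (hg : Function.Injective g)
    (ε s lo : Fin d → ℝ) (m : Fin d → ℕ)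
    (hε : ∀ i, 0 < ε i) (hεs : ∀ i, 2 * ε i < s i) (hm : ∀ i, 0 < m i)
    (P : Measure (GaussParam k))
    (hP : UniformSecretsPrior P g lo fun i => lo i + m i * s i) :
    unionPrivacy P g ε (quantizationMechanism g lo s)
        = ENNReal.ofReal (1 - ∏ i, (1 - 2 * ε i / s i)) ∧
      distortion P (quantizationMechanism g lo s) = ENNReal.ofReal √(∑ i, s i ^ 2) ∧
      ∀ c : ℝ, tradeoffConst ε s < c →
        distortion P (quantizationMechanism g lo s)
          < ENNReal.ofReal c *
            optDistortion P g ε (unionPrivacy P g ε (quantizationMechanism g lo s)) := by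
  have hs (i : Fin d) : 0 < s i := by linarith [hε i, hεs i]
  have := hP.isProbabilityMeasure
  have hpriv := unionPrivacy_quantizationMechanism hg hε hεs hP
  have hdist := distortion_quantizationMechanism hg hs hm hP
  refine ⟨hpriv, hdist, fun c hc => ?_⟩
  have hopt : ENNReal.ofReal (√(∑ i, s i ^ 2) / tradeoffConst ε s)
      ≤ optDistortion P g ε (unionPrivacy P g ε (quantizationMechanism g lo s)) :=
    le_iInf fun M => le_iInf₂ fun _ hM =>
      le_distortion_of_unionPrivacy_le hd hε hεs hP.sd_nonneg M (hM.trans_eq hpriv)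
  have hC := tradeoffConst_pos hd hε hεs
  have hnorm : 0 < √(∑ i, s i ^ 2) :=
    Real.sqrt_pos.2 (Finset.sum_pos (fun i _ => pow_pos (hs i) 2) ⟨⟨0, hd⟩, Finset.mem_univ _⟩)
  rw [hdist]
  -- Strictness comes from `c` exceeding the constant while the norm of `s` is positive; no optimal
  -- mechanism need exist.
  refine lt_of_lt_of_le ?_ (mul_le_mul_right hopt _)
  rw [← ENNReal.ofReal_mul (hC.trans hc).le,
    ENNReal.ofReal_lt_ofReal_iff (mul_pos (hC.trans hc) (div_pos hnorm hC)),
    ← mul_div_assoc, lt_div_iff₀ hC, mul_comm]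
  exact mul_lt_mul_of_pos_right hc hnorm
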